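/- \textbf{Lemma (Matrix Inversion Polynomial Approximation).} Let $\kappa\ge 1$ and $0<\varepsilon<1$ be real numbers, and let $\mathcal D_\kappa=[-1,-1/\kappa]\cup[1/\kappa,1]$. Let $\mathrm{rect}(u)=1$ for $|u|<\tfrac12$, $\mathrm{rect}(u)=\tfrac12$ for $|u|=\tfrac12$ and $\mathrm{rect}(u)=0$ for $|u|>\tfrac12$. Let $T_n$ be the Chebyshev polynomials of the first kind, $I_j(z)=\sum_{m\ge 0}\frac{(z/2)^{2m+j}}{m!\,(m+j)!}$ the modified Bessel functions of the first kind, and $\log$ the natural logarithm. \emph{Approximation of $1/x$.} For $0<\eta<1$ put $b=\lceil\kappa^2\log_2(\kappa/\eta)\rceil$, $j_0=j_0(\kappa,\eta)=\big\lceil\sqrt{b\log_2(4b/\eta)}\,\big\rceil$ and $$P_{1/x,\eta,\kappa}(x)=4\sum_{j=0}^{j_0}(-1)^j\left[2^{-2b}\sum_{i=j+1}^{b}\binom{2b}{b+i}\right]T_{2j+1}(x).$$ \emph{Low's approximation of the rectangle function.} For odd $n$ let $$p_{\mathrm{erf}}(x,k,n)=\frac{2k e^{-k^2/2}}{\sqrt\pi}\left[(-1)^{\frac{n-1}{2}}I_{\frac{n-1}{2}}\!\left(\tfrac{k^2}{2}\right)\frac{T_n(x)}{n}+\sum_{j=0}^{(n-3)/2}(-1)^j\left(I_j\!\left(\tfrac{k^2}{2}\right)+I_{j+1}\!\left(\tfrac{k^2}{2}\right)\right)\frac{T_{2j+1}(x)}{2j+1}\right].$$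 Let $n_{\exp}(\beta,\eta)=\Big\lceil\sqrt{2\log(4/\eta)\,\lceil\max(\beta e^2,\log(2/\eta))\rceil}\Big\rceil$. For $K>0$ and $0<\eta\le\tfrac12$ put $k=\frac{\sqrt2}{K}\sqrt{\log\frac{8}{\pi\eta^2}}$, $n=2n_{\exp}\!\big(2k^2,\frac{\sqrt\pi\,\eta}{16k}\big)+1$ and $p_{\mathrm{sign},K,\eta}(y)=p_{\mathrm{erf}}(y/2,2k,n)$. For $t,\delta>0$ let $$P_{\mathrm{rect},t,\delta,\eta}(x)=\tfrac12\Big(p_{\mathrm{sign},K,\eta}(x+a)-p_{\mathrm{sign},K,\eta}(x-a)\Big),\qquad a=t+\tfrac{\delta}{4},\quad K=\tfrac{\delta}{2}.$$ \emph{Claim.} Let $\varepsilon_{\mathrm{inv}}=\frac{\varepsilon}{2}$ and $\varepsilon_{\mathrm{rect}}=\min\!\left(\frac{\varepsilon}{2},\frac{\kappa}{2j_0}\right)$ with $j_0=j_0(\kappa,\varepsilon_{\mathrm{inv}})$, and define $$P_{\mathrm{MI},\varepsilon,\kappa}(x)=\frac{1-P_{\mathrm{rect},\frac{1}{2\kappa},\frac1\kappa,\varepsilon_{\mathrm{rect}}}(x)}{1+\varepsilon_{\mathrm{inv}}}\cdot\frac{P_{1/x,\varepsilon_{\mathrm{inv}},\kappa}(x)}{2\kappa}.$$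 Then \begin{itemize} \item $|P_{\mathrm{MI},\varepsilon,\kappa}(x)|\le 1$ for all $x\in[-1,1]$; \item $\left|P_{\mathrm{MI},\varepsilon,\kappa}(x)-\dfrac{1-\mathrm{rect}(\kappa x)}{2\kappa x}\right|\le\varepsilon$ for all $x\in\mathcal D_\kappa$. \end{itemize} -/

import Mathlib

noncomputable section

namespace MatrixInversion

open Polynomial

/-- The domain `D_κ = [-1, -1/κ] ∪ [1/κ, 1]`. -/
def invDomain (κ : ℝ) : Set ℝ :=
  Set.Icc (-1) (-(1 / κ)) ∪ Set.Icc (1 / κ) 1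

/-- The rectangle function of width one: `1` inside `(-1/2, 1/2)`, `1/2` at the two jumps,
`0` outside `[-1/2, 1/2]`. -/
def rect (u : ℝ) : ℝ :=
  if |u| < 1 / 2 then 1 else if |u| = 1 / 2 then 1 / 2 else 0

/-! The Chebyshev approximation of `1/x`. -/

/-- `b = ⌈κ² log₂(κ/ε)⌉`. -/
def invB (κ ε : ℝ) : ℕ := ⌈κ ^ 2 * Real.logb 2 (κ / ε)⌉₊

/-- `j₀ = ⌈√(b log₂(4b/ε))⌉`. -/
def invJ (κ ε : ℝ) : ℕ :=
  ⌈Real.sqrt ((invB κ ε : ℝ) * Real.logb 2 (4 * (invB κ ε : ℝ) / ε))⌉₊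

/-- `P_{1/x, ε, κ} = 4 ∑_{j=0}^{j₀} (-1)^j (2^{-2b} ∑_{i=j+1}^b (2b choose b+i)) T_{2j+1}`. -/
def invPoly (ε κ : ℝ) : ℝ[X] :=
  4 * ∑ j ∈ Finset.range (invJ κ ε + 1),
    C ((-1) ^ j *
        ((∑ i ∈ Finset.Icc (j + 1) (invB κ ε),
            (Nat.choose (2 * invB κ ε) (invB κ ε + i) : ℝ)) / 2 ^ (2 * invB κ ε))) *
      Chebyshev.T ℝ (2 * (j : ℤ) + 1)

/-! Low's approximations of the error, sign and rectangle functions. -/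

/-- The modified Bessel function of the first kind of integer order `j ≥ 0`,
`I_j(z) = ∑_m (z/2)^{2m+j} / (m! (m+j)!)`. -/
def besselI (j : ℕ) (z : ℝ) : ℝ :=
  ∑' m : ℕ, (z / 2) ^ (2 * m + j) / ((Nat.factorial m : ℝ) * (Nat.factorial (m + j) : ℝ))

/-- The series defining `I_j(z)` converges for every real `z`. -/
theorem summable_besselI (j : ℕ) (z : ℝ) :
    Summable fun m : ℕ =>
      (z / 2) ^ (2 * m + j) / ((Nat.factorial m : ℝ) * (Nat.factorial (m + j) : ℝ)) := by
  have h := (Real.summable_pow_div_factorial ((z / 2) ^ 2)).mul_left (|z / 2| ^ j)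
  refine Summable.of_norm_bounded h fun m => ?_
  have h1 : (1 : ℝ) ≤ (Nat.factorial (m + j) : ℝ) := by
    exact_mod_cast Nat.succ_le_of_lt (Nat.factorial_pos _)
  have h0 : (0 : ℝ) < (Nat.factorial m : ℝ) := by exact_mod_cast Nat.factorial_pos _
  have e : ‖(z / 2) ^ (2 * m + j) / ((Nat.factorial m : ℝ) * (Nat.factorial (m + j) : ℝ))‖
      = |z / 2| ^ j * ((z / 2) ^ 2) ^ m /
        ((Nat.factorial m : ℝ) * (Nat.factorial (m + j) : ℝ)) := by
    rw [norm_div, norm_pow, Real.norm_eq_abs, Real.norm_eq_abs, pow_add, pow_mul, sq_abs,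
      abs_of_pos (mul_pos h0 (by linarith)), mul_comm (|z / 2| ^ j)]
  rw [e, ← mul_div_assoc]
  refine div_le_div_of_nonneg_left (by positivity) h0 ?_
  nlinarith

/-- `p_erf(·, k, n)` for odd `n`: the truncated Chebyshev expansion, of degree at most `n`, of
`x ↦ erf(k x)`. -/
def erfPoly (k : ℝ) (n : ℕ) : ℝ[X] :=
  C (2 * k * Real.exp (-(k ^ 2 / 2)) / Real.sqrt Real.pi) *
    (C ((-1) ^ ((n - 1) / 2) * besselI ((n - 1) / 2) (k ^ 2 / 2) / (n : ℝ)) *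
        Chebyshev.T ℝ (n : ℤ) +
      ∑ j ∈ Finset.range ((n - 1) / 2),
        C ((-1) ^ j * (besselI j (k ^ 2 / 2) + besselI (j + 1) (k ^ 2 / 2)) /
            (2 * (j : ℝ) + 1)) *
          Chebyshev.T ℝ (2 * (j : ℤ) + 1))

/-- `n_exp(β, ε) = ⌈√(2 log(4/ε) ⌈max(β e², log(2/ε))⌉)⌉`. -/
def expDegree (β ε : ℝ) : ℕ :=
  ⌈Real.sqrt (2 * Real.log (4 / ε) *
    (⌈max (β * Real.exp 1 ^ 2) (Real.log (2 / ε))⌉₊ : ℝ))⌉₊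

/-- `k = (√2 / K) log^{1/2}(8 / (π ε²))`. -/
def signScale (K ε : ℝ) : ℝ :=
  Real.sqrt 2 / K * Real.sqrt (Real.log (8 / (Real.pi * ε ^ 2)))

/-- `n_rect = 2 n_exp(2k², √π ε / (16 k)) + 1`. -/
def rectDegree (K ε : ℝ) : ℕ :=
  2 * expDegree (2 * signScale K ε ^ 2) (Real.sqrt Real.pi * ε / (16 * signScale K ε)) + 1

/-- `p_sign(x, a, K, ε) = p_erf((x - a)/2, 2k, n_rect)`, an approximation of `sign (x - a)`. -/
def signPoly (a K ε : ℝ) : ℝ[X] :=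
  (erfPoly (2 * signScale K ε) (rectDegree K ε)).comp (C (1 / 2) * (X - C a))

/-- `p_{rect, t, δ, ε}(x) = (p_{sign, K, ε}(x + a) - p_{sign, K, ε}(x - a)) / 2` with
`a = t + δ/4` and `K = δ/2`, an approximation of `rect (x / (2t))`. -/
def rectPoly (t δ ε : ℝ) : ℝ[X] :=
  C (1 / 2) * (signPoly (-(t + δ / 4)) (δ / 2) ε - signPoly (t + δ / 4) (δ / 2) ε)

/-! The composite polynomial. -/

/-- `ε_inv = ε / 2`. -/
def epsInv (ε : ℝ) : ℝ := ε / 2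

/-- `ε_rect = min (ε/2) (κ / (2 j₀))`, with `j₀` the truncation index of `P_{1/x, ε_inv, κ}`. -/
def epsRect (ε κ : ℝ) : ℝ := min (ε / 2) (κ / (2 * (invJ κ (epsInv ε) : ℝ)))

/-- `P_{MI, ε, κ} =
(1 - P_{rect, 1/(2κ), 1/κ, ε_rect}) / (1 + ε_inv) · P_{1/x, ε_inv, κ} / (2κ)`. -/
def miPoly (ε κ : ℝ) : ℝ[X] :=
  C (1 / (1 + epsInv ε)) * (1 - rectPoly (1 / (2 * κ)) (1 / κ) (epsRect ε κ)) *
    (C (1 / (2 * κ)) * invPoly (epsInv ε) κ)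

end MatrixInversion

end

/-! The composite is a product of an approximate indicator of |x| ≳ 1/κ and an approximate 1/x, so
everything reduces to quantitative control of the two factors.

Rectangle factor. At `x = cos φ` the derivative of `erfPoly` is a symmetric partial sum of the
Bessel generating series for exp(z/2·(w + 1/w)) at w = -e^{2iφ}, and the full series gives a
Gaussian (`erfPoly_derivative_eval_cos`). A Chernoff bound controls the tail
(`norm_exp_sub_sum_besselI_le`, `exists_chernoff_le_of_expDegree`), and integrating from 0 compares
`erfPoly` with erf (`abs_erfPoly_sub_gaussErf_le`). Combined with 1 - erf z ≤ e^{-z²}, this yields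
`signPoly_bounds` and `rectPoly_bounds`.

Inverse factor. The full Chebyshev sum equals (1 - (1 - x²)^b)/x (`mul_sum_binomTail_T`). It is at
most 1/|x| in absolute value for every x ≠ 0 and close to 1/x for |x| ≥ 1/κ; its coefficients are
binomial tails, small beyond j₀ by another Chernoff bound (`binomTail_le_exp`).

The bound by 1 balances the factors: near 0 the polynomial for 1/x is only O(j₀), but there the
other factor is at most κ/(2j₀); farther out, 1/|x| is already at most 2κ. On the domain the target
is 1/(2κx), and the errors of the factors add up. -/

namespace MatrixInversion

open Polynomial

/-! ### Bessel generating function and its tails -/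

/-- A pair of naturals is determined by its difference and its minimum. -/
def diffMinEquiv : ℤ × ℕ ≃ ℕ × ℕ where
  toFun p := (p.2 + p.1.toNat, p.2 + (-p.1).toNat)
  invFun q := ((q.1 : ℤ) - q.2, min q.1 q.2)
  left_inv p := by
    ext
    · simp
    · simp
      omega
  right_inv q := by
    ext <;> simp <;> omega

theorem hasSum_besselI (j : ℕ) (z : ℝ) :
    HasSum (fun m : ℕ =>
      (z / 2) ^ (2 * m + j) / ((Nat.factorial m : ℝ) * (Nat.factorial (m + j) : ℝ)))
      (besselI j z) :=
  (summable_besselI j z).hasSum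

theorem besselI_nonneg (j : ℕ) {z : ℝ} (hz : 0 ≤ z) : 0 ≤ besselI j z :=
  tsum_nonneg fun m => by positivity

/-- One of `j.toNat`, `(-j).toNat` vanishes, so their difference is j and their sum is |j|. This
regroups the product of the series for e^{uw} and e^{u/w} by powers of w. -/
theorem exp_series_mul_term (u : ℂ) {w : ℂ} (hw : w ≠ 0) (j : ℤ) (m : ℕ) :
    (u * w) ^ (m + j.toNat) / (Nat.factorial (m + j.toNat) : ℂ) *
        ((u * w⁻¹) ^ (m + (-j).toNat) / (Nat.factorial (m + (-j).toNat) : ℂ)) =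
      u ^ (2 * m + j.natAbs) /
        ((Nat.factorial m : ℂ) * (Nat.factorial (m + j.natAbs) : ℂ)) * w ^ j := by
  obtain ⟨n, rfl | rfl⟩ := j.eq_nat_or_neg
  · simp only [Int.toNat_natCast, Int.toNat_neg_natCast, Int.natAbs_natCast, add_zero,
      zpow_natCast, mul_pow, inv_pow, pow_add]
    field_simp
    ring
  · simp only [Int.toNat_natCast, Int.toNat_neg_natCast, Int.natAbs_natCast, add_zero,
      zpow_natCast, neg_neg, Int.natAbs_neg, zpow_neg, mul_pow, inv_pow, pow_add]
    field_simp
    ring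

theorem hasSum_exp_series (u : ℂ) :
    HasSum (fun n : ℕ => u ^ n / (Nat.factorial n : ℂ)) (Complex.exp u) := by
  rw [Complex.exp_eq_exp_ℂ]
  exact NormedSpace.expSeries_div_hasSum_exp u

theorem summable_norm_exp_series (u : ℂ) :
    Summable fun n : ℕ => ‖u ^ n / (Nat.factorial n : ℂ)‖ := by
  simpa using Real.summable_pow_div_factorial ‖u‖

theorem hasSum_exp_mul_add_inv (u : ℂ) {w : ℂ} (hw : w ≠ 0) :
    HasSum (fun p : ℤ × ℕ => u ^ (2 * p.2 + p.1.natAbs) /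
      ((Nat.factorial p.2 : ℂ) * (Nat.factorial (p.2 + p.1.natAbs) : ℂ)) * w ^ p.1)
      (Complex.exp (u * (w + w⁻¹))) := by
  have hs := summable_mul_of_summable_norm
    (f := fun n : ℕ => (u * w) ^ n / (Nat.factorial n : ℂ))
    (g := fun n : ℕ => (u * w⁻¹) ^ n / (Nat.factorial n : ℂ))
    (summable_norm_exp_series (u * w)) (summable_norm_exp_series (u * w⁻¹))
  have hprod := HasSum.mul (f := fun n : ℕ => (u * w) ^ n / (Nat.factorial n : ℂ))
    (g := fun n : ℕ => (u * w⁻¹) ^ n / (Nat.factorial n : ℂ))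
    (hasSum_exp_series (u * w)) (hasSum_exp_series (u * w⁻¹)) hs
  have he : Complex.exp (u * (w + w⁻¹)) = Complex.exp (u * w) * Complex.exp (u * w⁻¹) := by
    rw [mul_add, Complex.exp_add]
  rw [he, ← funext fun p : ℤ × ℕ => exp_series_mul_term u hw p.1 p.2]
  exact diffMinEquiv.hasSum_iff.mpr hprod

/-- The generating function of the modified Bessel functions. -/
theorem hasSum_besselI_mul_zpow (z : ℝ) {w : ℂ} (hw : w ≠ 0) :
    HasSum (fun j : ℤ => (besselI j.natAbs z : ℂ) * w ^ j)
      (Complex.exp (z / 2 * (w + w⁻¹))) := by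
  refine (hasSum_exp_mul_add_inv (z / 2) hw).prod_fiberwise fun j => ?_
  have hj := (Complex.hasSum_ofReal.mpr (hasSum_besselI j.natAbs z)).mul_right (w ^ j)
  push_cast at hj
  exact hj

/-- The generating function at the positive point w = e^θ; its terms are nonnegative for z ≥ 0 and
serve as a majorant for tails on the unit circle. -/
theorem hasSum_besselI_mul_exp (z θ : ℝ) :
    HasSum (fun j : ℤ => besselI j.natAbs z * Real.exp (θ * j))
      (Real.exp (z * Real.cosh θ)) := by
  have h := hasSum_besselI_mul_zpow z (w := (Real.exp θ : ℂ)) (by simp)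
  rw [← Complex.hasSum_ofReal]
  convert h using 1
  · ext j
    push_cast
    rw [← Complex.exp_int_mul, mul_comm (θ : ℂ)]
  · rw [Real.cosh_eq]
    push_cast
    rw [← Complex.exp_neg]
    ring_nf

/-- A Chernoff bound for the tail of the generating function of the Bessel functions. -/
theorem norm_exp_sub_sum_besselI_le {z θ : ℝ} (hz : 0 ≤ z) (hθ : 0 ≤ θ) {w : ℂ} (hw : ‖w‖ = 1)
    (N : ℕ) :
    ‖Complex.exp (z / 2 * (w + w⁻¹)) -
        ∑ j ∈ Finset.Icc (-(N : ℤ)) N, (besselI j.natAbs z : ℂ) * w ^ j‖ ≤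
      2 * Real.exp (z * Real.cosh θ - θ * N) := by
  have hw0 : w ≠ 0 := by
    rintro rfl
    simp at hw
  have h1 := (hasSum_besselI_mul_zpow z hw0).sub
    (hasSum_sum_of_ne_finset_zero
      (f := fun j : ℤ => if j ∈ Finset.Icc (-(N : ℤ)) N then (besselI j.natAbs z : ℂ) * w ^ j else 0)
      (s := Finset.Icc (-(N : ℤ)) N) (fun j hj => if_neg hj))
  rw [Finset.sum_congr rfl (fun j hj => if_pos hj)] at h1
  -- Adding the series at θ and -θ handles both tails at once: the weight (e^{θj} + e^{-θj})e^{-θN}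
  -- is at least 1 once |j| > N.
  have h2 := ((hasSum_besselI_mul_exp z θ).add (hasSum_besselI_mul_exp z (-θ))).mul_right
    (Real.exp (-(θ * N)))
  rw [Real.cosh_neg, ← two_mul, mul_assoc, ← Real.exp_add, ← sub_eq_add_neg] at h2
  refine h1.norm_le_of_bounded h2 fun j => ?_
  have hI := besselI_nonneg j.natAbs hz
  by_cases hj : j ∈ Finset.Icc (-(N : ℤ)) N
  · simp only [if_pos hj, sub_self, norm_zero]
    positivity
  · rw [if_neg hj, sub_zero, norm_mul, norm_zpow, hw, one_zpow, mul_one, Complex.norm_real,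
      Real.norm_of_nonneg hI, ← mul_add, mul_assoc]
    refine le_mul_of_one_le_right hI ?_
    rw [add_mul, ← Real.exp_add, ← Real.exp_add]
    rw [Finset.mem_Icc, not_and_or, not_le, not_le] at hj
    rcases hj with hj | hj
    · have : (j : ℝ) ≤ -N := by exact_mod_cast hj.le
      have : 1 ≤ Real.exp (-θ * j + -(θ * N)) := Real.one_le_exp (by nlinarith)
      have := Real.exp_pos (θ * j + -(θ * N))
      linarith
    · have : (N : ℝ) ≤ j := by exact_mod_cast hj.le
      have : 1 ≤ Real.exp (θ * j + -(θ * N)) := Real.one_le_exp (by nlinarith)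
      have := Real.exp_pos (-θ * j + -(θ * N))
      linarith

/-! ### Derivative of the truncated erf expansion -/

/-- Differentiation turns T_{2j+1}/(2j+1) into U_{2j}. The coefficients I_j + I_{j+1} then regroup
through U_{2j+2} - U_{2j} = 2T_{2j+2}; the lone I_N on the top term is what makes this exact. -/
theorem erfPoly_derivative (k : ℝ) (N : ℕ) :
    derivative (erfPoly k (2 * N + 1)) =
      C (2 * k * Real.exp (-(k ^ 2 / 2)) / Real.sqrt Real.pi) *
        (C (besselI 0 (k ^ 2 / 2)) +
          ∑ j ∈ Finset.range N, C (2 * (-1) ^ (j + 1) * besselI (j + 1) (k ^ 2 / 2)) *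
            Chebyshev.T ℝ (2 * (j : ℤ) + 2)) := by
  have hT (j : ℕ) (a : ℝ) : C (a / (2 * (j : ℝ) + 1)) *
      derivative (Chebyshev.T ℝ (2 * (j : ℤ) + 1)) = C a * Chebyshev.U ℝ (2 * j) := by
    have h0 : (2 * (j : ℝ) + 1) ≠ 0 := by positivity
    have hc : ((2 * (j : ℤ) + 1 : ℤ) : ℝ[X]) = C (2 * (j : ℝ) + 1) := by
      simp [map_ofNat C 2]
    rw [Chebyshev.T_derivative_eq_U, hc, ← mul_assoc, ← C_mul, div_mul_cancel₀ _ h0,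
      add_sub_cancel_right]
  have hN : (2 * N + 1 - 1) / 2 = N := by omega
  rw [erfPoly, hN, derivative_C_mul, derivative_add, derivative_sum, derivative_C_mul]
  simp only [derivative_C_mul]
  push_cast
  simp only [hT]
  congr 1
  induction N with
  | zero => simp
  | succ N ih =>
    have hN' : (2 * N + 1 - 1) / 2 = N := by omega
    rw [Finset.sum_range_succ, Finset.sum_range_succ, ← add_assoc (C (besselI 0 _)), ← ih hN']
    have hU := Chebyshev.two_mul_T_eq_U_sub_U ℝ (2 * (N : ℤ))
    have e : (2 * ((N + 1 : ℕ) : ℤ)) = 2 * (N : ℤ) + 2 := by push_cast; ring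
    rw [e, show (C (2 * (-1) ^ (N + 1) * besselI (N + 1) (k ^ 2 / 2)) : ℝ[X]) *
      Chebyshev.T ℝ (2 * (N : ℤ) + 2) = C ((-1) ^ (N + 1) * besselI (N + 1) (k ^ 2 / 2)) *
      (2 * Chebyshev.T ℝ (2 * (N : ℤ) + 2)) by
        rw [mul_assoc 2, C_mul]; simp only [map_ofNat]; ring, hU]
    simp only [C_mul, C_add, C_pow, C_neg, C_1, pow_succ]
    ring

/-- For w = -e^{2iφ}, w^j + w^{-j} = 2(-1)^j cos(2jφ), which matches the signs and even degrees of
the derivative. -/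
theorem erfPoly_derivative_eval_cos (k φ : ℝ) (N : ℕ) :
    (((derivative (erfPoly k (2 * N + 1))).eval (Real.cos φ) : ℝ) : ℂ) =
      (2 * k * Real.exp (-(k ^ 2 / 2)) / Real.sqrt Real.pi : ℝ) *
        ∑ j ∈ Finset.Icc (-(N : ℤ)) N,
          (besselI j.natAbs (k ^ 2 / 2) : ℂ) * (-Complex.exp (2 * φ * Complex.I)) ^ j := by
  have hexp (n : ℤ) : ((-Complex.exp (2 * φ * Complex.I)) ^ n +
      (-Complex.exp (2 * φ * Complex.I)) ^ (-n)) = 2 * (-1) ^ n * Complex.cos (2 * n * φ) := by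
    have h1 : (-Complex.exp (2 * φ * Complex.I)) = (-1) * Complex.exp (2 * φ * Complex.I) := by
      ring
    rw [h1, mul_zpow, mul_zpow, ← Complex.exp_int_mul, ← Complex.exp_int_mul, zpow_neg,
      ← inv_zpow, inv_neg, inv_one, Complex.cos]
    push_cast
    ring_nf
  rw [erfPoly_derivative, eval_mul, eval_C]
  push_cast
  congr 1
  rw [eval_add, eval_C, eval_finsetSum]
  simp only [eval_mul, eval_C, Chebyshev.T_real_cos]
  induction N with
  | zero => simp
  | succ N ih =>
    have hI : Finset.Icc (-((N + 1 : ℕ) : ℤ)) ((N + 1 : ℕ) : ℤ) =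
        insert (-((N + 1 : ℕ) : ℤ)) (insert (((N + 1 : ℕ) : ℤ)) (Finset.Icc (-(N : ℤ)) N)) := by
      ext j
      simp only [Finset.mem_insert, Finset.mem_Icc]
      omega
    rw [hI, Finset.sum_insert (by simp; omega), Finset.sum_insert (by simp), ← ih,
      Finset.sum_range_succ]
    have h : (-Complex.exp (2 * φ * Complex.I)) ^ ((N + 1 : ℕ) : ℤ) +
        (-Complex.exp (2 * φ * Complex.I)) ^ (-((N + 1 : ℕ) : ℤ)) =
        (2 * (-1) ^ (N + 1) * Real.cos (((2 * (N : ℤ) + 2 : ℤ) : ℝ) * φ) : ℝ) := by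
      rw [hexp]
      push_cast
      rw [zpow_add₀ (by simp), zpow_natCast, zpow_one, pow_succ,
        show (2 * (N : ℂ) + 2) * φ = 2 * (N + 1) * φ by ring]
    rw [Int.natAbs_neg, Int.natAbs_natCast, ← add_assoc (besselI 0 _),
      Complex.ofReal_add _ (_ * _ * Real.cos _),
      show 2 * (-1) ^ (N + 1) * besselI (N + 1) (k ^ 2 / 2) *
        Real.cos (((2 * (N : ℤ) + 2 : ℤ) : ℝ) * φ) = besselI (N + 1) (k ^ 2 / 2) *
        (2 * (-1) ^ (N + 1) * Real.cos (((2 * (N : ℤ) + 2 : ℤ) : ℝ) * φ)) by ring,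
      Complex.ofReal_mul (besselI _ _), ← h]
    ring

theorem exists_chernoff_le_of_expDegree {β ε : ℝ} (hβ : 0 ≤ β) (hε0 : 0 < ε) (hε1 : ε ≤ 1) :
    ∃ θ : ℝ, 0 ≤ θ ∧
      Real.exp (-β) * (2 * Real.exp (β * Real.cosh θ - θ * expDegree β ε)) ≤ ε / 2 := by
  set t : ℝ := (⌈max (β * Real.exp 1 ^ 2) (Real.log (2 / ε))⌉₊ : ℝ) with ht
  set l : ℝ := Real.log (4 / ε) with hl
  have hmax : max (β * Real.exp 1 ^ 2) (Real.log (2 / ε)) ≤ t := Nat.le_ceil _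
  have ht1 : β * Real.exp 1 ^ 2 ≤ t := (le_max_left _ _).trans hmax
  have ht2 : Real.log (2 / ε) ≤ t := (le_max_right _ _).trans hmax
  have hlog2 : 0 < Real.log 2 := Real.log_pos one_lt_two
  have h2ε : Real.log 2 ≤ Real.log (2 / ε) := by
    refine Real.log_le_log two_pos ?_
    rw [le_div_iff₀ hε0]
    linarith
  have hl2 : l = Real.log 2 + Real.log (2 / ε) := by
    rw [hl, ← Real.log_mul two_ne_zero (by positivity)]
    congr 1
    ring
  have htpos : 0 < t := by linarith
  have hlpos : 0 < l := by linarith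
  have hlt : l / t ≤ 2 := by
    rw [div_le_iff₀ htpos]
    linarith
  have hN : Real.sqrt (2 * l * t) ≤ expDegree β ε := Nat.le_ceil _
  -- Since the degree is at least √(2lt), this θ makes θ·degree ≥ 2l. The growth β(cosh θ - 1) costs
  -- at most l, so a factor e^{-l} = ε/4 remains.
  refine ⟨Real.sqrt (2 * l / t), Real.sqrt_nonneg _, ?_⟩
  have hθN : 2 * l ≤ Real.sqrt (2 * l / t) * expDegree β ε := by
    have h := mul_le_mul_of_nonneg_left hN (Real.sqrt_nonneg (2 * l / t))
    rw [← Real.sqrt_mul (by positivity),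
      show 2 * l / t * (2 * l * t) = (2 * l) ^ 2 by field_simp, Real.sqrt_sq (by positivity)] at h
    exact h
  -- With y = θ²/2 = l/t ≤ 2: cosh θ - 1 ≤ e^y - 1 ≤ y e^y ≤ y e². This is the source of e² in the
  -- degree.
  have hcosh : Real.cosh (Real.sqrt (2 * l / t)) - 1 ≤ l / t * Real.exp 1 ^ 2 := by
    have h1 := Real.cosh_le_exp_half_sq (Real.sqrt (2 * l / t))
    rw [Real.sq_sqrt (by positivity), show 2 * l / t / 2 = l / t by ring] at h1
    have h2 : 1 - l / t ≤ Real.exp (-(l / t)) := by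
      linarith [Real.add_one_le_exp (-(l / t))]
    have h3 : Real.exp (l / t) ≤ Real.exp 1 ^ 2 := by
      rw [← Real.exp_nat_mul]
      exact Real.exp_le_exp.mpr (by push_cast; linarith)
    have h4 : Real.exp (l / t) * Real.exp (-(l / t)) = 1 := by
      rw [← Real.exp_add, add_neg_cancel, Real.exp_zero]
    have h5 : 0 ≤ l / t := by positivity
    have h6 := mul_le_mul_of_nonneg_left h2 (Real.exp_pos (l / t)).le
    have h7 := mul_le_mul_of_nonneg_left h3 h5
    linarith
  have hβl : β * (Real.cosh (Real.sqrt (2 * l / t)) - 1) ≤ l := by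
    calc β * (Real.cosh (Real.sqrt (2 * l / t)) - 1) ≤ β * (l / t * Real.exp 1 ^ 2) :=
          mul_le_mul_of_nonneg_left hcosh hβ
      _ = (β * Real.exp 1 ^ 2) * (l / t) := by ring
      _ ≤ t * (l / t) := mul_le_mul_of_nonneg_right ht1 (by positivity)
      _ = l := by field_simp
  have hexp : Real.exp (-l) = ε / 4 := by
    rw [hl, Real.exp_neg, Real.exp_log (by positivity), inv_div]
  rw [mul_left_comm, ← Real.exp_add]
  have : Real.exp (-β + (β * Real.cosh (Real.sqrt (2 * l / t)) -
      Real.sqrt (2 * l / t) * expDegree β ε)) ≤ Real.exp (-l) :=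
    Real.exp_le_exp.mpr (by linarith)
  linarith

theorem abs_erfPoly_derivative_sub_le {k ε x : ℝ} (hk : 0 ≤ k) (hε0 : 0 < ε) (hε1 : ε ≤ 1)
    (hx : x ∈ Set.Icc (-1 : ℝ) 1) :
    |(derivative (erfPoly k (2 * expDegree (k ^ 2 / 2) ε + 1))).eval x -
        2 * k / Real.sqrt Real.pi * Real.exp (-(k * x) ^ 2)| ≤
      2 * k / Real.sqrt Real.pi * (ε / 2) := by
  obtain ⟨φ, rfl⟩ : ∃ φ, Real.cos φ = x := ⟨Real.arccos x, Real.cos_arccos hx.1 hx.2⟩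
  obtain ⟨θ, hθ, hle⟩ := exists_chernoff_le_of_expDegree (β := k ^ 2 / 2) (by positivity) hε0 hε1
  set N := expDegree (k ^ 2 / 2) ε
  set c := 2 * k / Real.sqrt Real.pi with hc
  have hc0 : 0 ≤ c := by positivity
  set w : ℂ := -Complex.exp (2 * φ * Complex.I) with hw
  have hw1 : ‖w‖ = 1 := by
    rw [hw, norm_neg,
      show (2 * φ * Complex.I : ℂ) = ((2 * φ : ℝ) : ℂ) * Complex.I by push_cast; ring,
      Complex.norm_exp_ofReal_mul_I]
  have hwinv : w + w⁻¹ = ((-2 * Real.cos (2 * φ) : ℝ) : ℂ) := by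
    rw [hw, inv_neg, ← Complex.exp_neg]
    push_cast
    rw [Complex.cos]
    ring_nf
  have htail := norm_exp_sub_sum_besselI_le (z := k ^ 2 / 2) (by positivity) hθ hw1 N
  have hp := erfPoly_derivative_eval_cos k φ N
  -- w + 1/w = -2 cos 2φ, and 1 + cos 2φ = 2 cos² φ merges the two exponentials into the Gaussian at
  -- k cos φ.
  have hgauss : ((c * Real.exp (-(k * Real.cos φ) ^ 2) : ℝ) : ℂ) =
      ((c * Real.exp (-(k ^ 2 / 2)) : ℝ) : ℂ) *
        Complex.exp ((k ^ 2 / 2 : ℝ) / 2 * (w + w⁻¹)) := by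
    rw [hwinv, show (((k ^ 2 / 2 : ℝ) : ℂ) / 2 * ((-2 * Real.cos (2 * φ) : ℝ) : ℂ)) =
      ((-(k ^ 2 / 2) * Real.cos (2 * φ) : ℝ) : ℂ) by push_cast; ring, ← Complex.ofReal_exp,
      ← Complex.ofReal_mul, mul_assoc, ← Real.exp_add, Real.cos_two_mul]
    congr 3
    ring
  rw [← Real.norm_eq_abs, ← Complex.norm_real, Complex.ofReal_sub, hp, hgauss,
    show 2 * k * Real.exp (-(k ^ 2 / 2)) / Real.sqrt Real.pi = c * Real.exp (-(k ^ 2 / 2)) by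
      rw [hc]; ring, ← mul_sub, norm_mul, norm_sub_rev, Complex.norm_real,
    Real.norm_of_nonneg (by positivity), mul_assoc]
  refine mul_le_mul_of_nonneg_left (le_trans ?_ hle) hc0
  exact mul_le_mul_of_nonneg_left htail (Real.exp_pos _).le

/-! ### The error function and its Gaussian tail -/

/-- The error function. -/
noncomputable def gaussErf (x : ℝ) : ℝ := 2 / Real.sqrt Real.pi * ∫ s in (0 : ℝ)..x, Real.exp (-s ^ 2)

theorem continuous_exp_neg_sq : Continuous fun s : ℝ => Real.exp (-s ^ 2) := by fun_prop

theorem hasDerivAt_gaussErf (x : ℝ) :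
    HasDerivAt gaussErf (2 / Real.sqrt Real.pi * Real.exp (-x ^ 2)) x :=
  (intervalIntegral.integral_hasDerivAt_right
    (continuous_exp_neg_sq.intervalIntegrable _ _)
    (continuous_exp_neg_sq.stronglyMeasurableAtFilter _ _)
    continuous_exp_neg_sq.continuousAt).const_mul _

theorem gaussErf_zero : gaussErf 0 = 0 := by simp [gaussErf]

theorem gaussErf_neg (x : ℝ) : gaussErf (-x) = -gaussErf x := by
  have h := intervalIntegral.integral_comp_neg (a := 0) (b := -x) fun s : ℝ => Real.exp (-s ^ 2)
  simp only [even_two.neg_pow, neg_neg, neg_zero] at h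
  rw [gaussErf, gaussErf, h, intervalIntegral.integral_symm, mul_neg]

theorem tendsto_gaussErf_atTop : Filter.Tendsto gaussErf Filter.atTop (nhds 1) := by
  have hi : MeasureTheory.IntegrableOn (fun s : ℝ => Real.exp (-s ^ 2)) (Set.Ioi 0) := by
    simpa using (integrable_exp_neg_mul_sq one_pos).integrableOn (s := Set.Ioi 0)
  have h := (MeasureTheory.intervalIntegral_tendsto_integral_Ioi 0 hi Filter.tendsto_id).const_mul
    (2 / Real.sqrt Real.pi)
  have hv : ∫ s in Set.Ioi (0 : ℝ), Real.exp (-s ^ 2) = Real.sqrt Real.pi / 2 := by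
    simpa using integral_gaussian_Ioi 1
  rw [hv, show 2 / Real.sqrt Real.pi * (Real.sqrt Real.pi / 2) = 1 by
    have : Real.sqrt Real.pi ≠ 0 := by positivity
    field_simp] at h
  exact h

theorem gaussErf_monotone : Monotone gaussErf := by
  refine monotone_of_hasDerivAt_nonneg hasDerivAt_gaussErf fun x => ?_
  simp only [Pi.zero_apply]
  positivity

theorem gaussErf_le_one (x : ℝ) : gaussErf x ≤ 1 :=
  gaussErf_monotone.ge_of_tendsto tendsto_gaussErf_atTop x

theorem neg_one_le_gaussErf (x : ℝ) : -1 ≤ gaussErf x := by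
  have := gaussErf_le_one (-x)
  rw [gaussErf_neg] at this
  linarith

/-- For s, z ≥ 0, (s + z)² ≥ s² + z², so the increment is at most e^{-z²} erf x. Letting x → ∞ gives
the tail bound. -/
theorem gaussErf_add_le {z x : ℝ} (hz : 0 ≤ z) (hx : 0 ≤ x) :
    gaussErf (z + x) ≤ gaussErf z + Real.exp (-z ^ 2) := by
  have hshift : gaussErf (z + x) - gaussErf z =
      2 / Real.sqrt Real.pi * ∫ s in (0 : ℝ)..x, Real.exp (-(s + z) ^ 2) := by
    rw [gaussErf, gaussErf, ← mul_sub, intervalIntegral.integral_interval_sub_left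
      (continuous_exp_neg_sq.intervalIntegrable _ _) (continuous_exp_neg_sq.intervalIntegrable _ _),
      intervalIntegral.integral_comp_add_right fun s : ℝ => Real.exp (-s ^ 2), zero_add, add_comm x]
  have hle : ∫ s in (0 : ℝ)..x, Real.exp (-(s + z) ^ 2) ≤
      ∫ s in (0 : ℝ)..x, Real.exp (-z ^ 2) * Real.exp (-s ^ 2) := by
    refine intervalIntegral.integral_mono_on hx
      (Continuous.intervalIntegrable (by fun_prop) _ _)
      (Continuous.intervalIntegrable (by fun_prop) _ _) fun s hs => ?_
    rw [← Real.exp_add]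
    exact Real.exp_le_exp.mpr (by nlinarith [mul_nonneg hs.1 hz])
  rw [intervalIntegral.integral_const_mul] at hle
  have h1 := mul_le_mul_of_nonneg_left hle (show 0 ≤ 2 / Real.sqrt Real.pi by positivity)
  rw [← hshift, mul_left_comm, ← gaussErf] at h1
  have h2 := mul_le_mul_of_nonneg_left (gaussErf_le_one x) (Real.exp_pos (-z ^ 2)).le
  linarith

theorem one_sub_gaussErf_le {z : ℝ} (hz : 0 ≤ z) : 1 - gaussErf z ≤ Real.exp (-z ^ 2) := by
  have h := le_of_tendsto (tendsto_gaussErf_atTop.comp (Filter.tendsto_atTop_add_const_left _ z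
    Filter.tendsto_id)) ((Filter.eventually_ge_atTop 0).mono fun x hx => gaussErf_add_le hz hx)
  linarith

/-! ### Polynomial approximation of erf, sign and rectangle -/

theorem erfPoly_eval_zero (k : ℝ) (N : ℕ) : (erfPoly k (2 * N + 1)).eval 0 = 0 := by
  have hodd (j : ℕ) : (Chebyshev.T ℝ (2 * (j : ℤ) + 1)).eval 0 = 0 :=
    Chebyshev.T_eval_zero_of_odd ℝ ⟨j, rfl⟩
  rw [erfPoly]
  push_cast
  simp [eval_finsetSum, hodd]

/-- The truncated Chebyshev expansion approximates the error function. -/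
theorem abs_erfPoly_sub_gaussErf_le {k ε x : ℝ} (hk : 0 ≤ k) (hε0 : 0 < ε) (hε1 : ε ≤ 1)
    (hx : x ∈ Set.Icc (-1 : ℝ) 1) :
    |(erfPoly k (2 * expDegree (k ^ 2 / 2) ε + 1)).eval x - gaussErf (k * x)| ≤
      2 * k / Real.sqrt Real.pi * (ε / 2) := by
  have hd (y : ℝ) : HasDerivAt
      (fun y => (erfPoly k (2 * expDegree (k ^ 2 / 2) ε + 1)).eval y - gaussErf (k * y))
      ((derivative (erfPoly k (2 * expDegree (k ^ 2 / 2) ε + 1))).eval y -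
        2 * k / Real.sqrt Real.pi * Real.exp (-(k * y) ^ 2)) y := by
    have h := (hasDerivAt_gaussErf (k * y)).comp y ((hasDerivAt_id y).const_mul k)
    refine ((Polynomial.hasDerivAt _ y).sub h).congr_deriv ?_
    ring
  -- Both functions vanish at 0 and |x| ≤ 1, so the mean value inequality passes the derivative
  -- error on unchanged.
  have h := (convex_Icc (-1 : ℝ) 1).norm_image_sub_le_of_norm_hasDerivWithin_le
    (fun y _ => (hd y).hasDerivWithinAt)
    (fun y hy => abs_erfPoly_derivative_sub_le hk hε0 hε1 hy)
    (show (0 : ℝ) ∈ Set.Icc (-1 : ℝ) 1 by simp) hx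
  rw [erfPoly_eval_zero, mul_zero, gaussErf_zero, sub_zero, sub_zero, sub_zero] at h
  refine h.trans (mul_le_of_le_one_right (by positivity) ?_)
  exact abs_le.mpr hx

theorem one_le_log_eight_div {η : ℝ} (h0 : 0 < η) (h1 : η ≤ 1 / 2) :
    1 ≤ Real.log (8 / (Real.pi * η ^ 2)) := by
  have hη2 : η ^ 2 ≤ 1 / 4 := by nlinarith
  rw [Real.le_log_iff_exp_le (by positivity), le_div_iff₀ (by positivity)]
  have he := Real.exp_one_lt_three
  have hπ := Real.pi_lt_four
  calc Real.exp 1 * (Real.pi * η ^ 2) ≤ 3 * (4 * (1 / 4)) := by gcongr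
    _ ≤ 8 := by norm_num

theorem one_le_signScale {K η : ℝ} (hK0 : 0 < K) (hK1 : K ≤ 1) (h0 : 0 < η) (h1 : η ≤ 1 / 2) :
    1 ≤ signScale K η := by
  have hl : 1 ≤ Real.sqrt (Real.log (8 / (Real.pi * η ^ 2))) :=
    Real.one_le_sqrt.mpr (one_le_log_eight_div h0 h1)
  have hs : 1 ≤ Real.sqrt 2 / K := by
    rw [one_le_div hK0]
    exact hK1.trans (Real.one_le_sqrt.mpr one_le_two)
  exact one_le_mul_of_one_le_of_one_le hs hl

/-- The left side is exactly √(π/8)·η. The constant 7/8 leaves η/8 for the polynomial error. -/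
theorem exp_neg_signScale_sq_le {K η : ℝ} (hK0 : 0 < K) (h0 : 0 < η) (h1 : η ≤ 1 / 2) :
    Real.exp (-(signScale K η * (K / 2)) ^ 2) ≤ 7 / 8 * η := by
  have hl := one_le_log_eight_div h0 h1
  have hsq : (signScale K η * (K / 2)) ^ 2 = Real.log (8 / (Real.pi * η ^ 2)) / 2 := by
    rw [signScale, show Real.sqrt 2 / K * Real.sqrt (Real.log (8 / (Real.pi * η ^ 2))) * (K / 2) =
      Real.sqrt 2 * Real.sqrt (Real.log (8 / (Real.pi * η ^ 2))) / 2 by field_simp,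
      div_pow, mul_pow, Real.sq_sqrt zero_le_two, Real.sq_sqrt (by linarith)]
    ring
  have hexp : Real.exp (-(signScale K η * (K / 2)) ^ 2) ^ 2 = Real.pi * η ^ 2 / 8 := by
    rw [← Real.exp_nat_mul, hsq]
    push_cast
    rw [show 2 * -(Real.log (8 / (Real.pi * η ^ 2)) / 2) =
      -Real.log (8 / (Real.pi * η ^ 2)) by ring, Real.exp_neg, Real.exp_log (by positivity),
      inv_div]
  refine le_of_sq_le_sq ?_ (by positivity)
  rw [hexp]
  nlinarith [Real.pi_lt_four, sq_nonneg η]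

theorem abs_signPoly_sub_gaussErf_le {a K η x : ℝ} (hK0 : 0 < K) (hK1 : K ≤ 1) (h0 : 0 < η)
    (h1 : η ≤ 1 / 2) (hx : |x - a| ≤ 2) :
    |(signPoly a K η).eval x - gaussErf (signScale K η * (x - a))| ≤ η / 8 := by
  have hs := one_le_signScale hK0 hK1 h0 h1
  set s := signScale K η with hsdef
  have hπ : 0 < Real.sqrt Real.pi := by positivity
  have hπ4 : Real.sqrt Real.pi ≤ 2 := by
    rw [Real.sqrt_le_left zero_le_two]
    linarith [Real.pi_lt_four]
  have hε1 : Real.sqrt Real.pi * η / (16 * s) ≤ 1 := by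
    rw [div_le_one (by positivity)]
    nlinarith
  have hx' : (x - a) / 2 ∈ Set.Icc (-1 : ℝ) 1 := by
    rw [abs_le] at hx
    constructor <;> linarith
  have h := abs_erfPoly_sub_gaussErf_le (k := 2 * s) (by positivity)
    (show 0 < Real.sqrt Real.pi * η / (16 * s) by positivity) hε1 hx'
  rw [show (2 * s) ^ 2 / 2 = 2 * s ^ 2 by ring, show 2 * s * ((x - a) / 2) = s * (x - a) by ring]
    at h
  have he : (signPoly a K η).eval x = (erfPoly (2 * s)
      (2 * expDegree (2 * s ^ 2) (Real.sqrt Real.pi * η / (16 * s)) + 1)).eval ((x - a) / 2) := by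
    rw [signPoly, rectDegree, eval_comp, ← hsdef]
    congr 1
    simp
    ring
  rw [he]
  -- The bound is (4s/√π)·(√π η/(32 s)) = η/8.
  refine h.trans (le_of_eq ?_)
  field_simp
  norm_num

/-- Outside the transition zone the budget is 7η/8 for erf and η/8 for the polynomial. The last two
bounds use only the sign of erf, so they also hold inside the zone. -/
theorem signPoly_bounds {a K η x : ℝ} (hK0 : 0 < K) (hK1 : K ≤ 1) (h0 : 0 < η)
    (h1 : η ≤ 1 / 2) (hx : |x - a| ≤ 2) :
    |(signPoly a K η).eval x| ≤ 1 + η ∧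
    (K / 2 ≤ x - a → |(signPoly a K η).eval x - 1| ≤ η) ∧
    (x - a ≤ -(K / 2) → |(signPoly a K η).eval x + 1| ≤ η) ∧
    (0 ≤ x - a → -η ≤ (signPoly a K η).eval x) ∧
    (x - a ≤ 0 → (signPoly a K η).eval x ≤ η) := by
  have hs := one_le_signScale hK0 hK1 h0 h1
  have hS := abs_le.mp (abs_signPoly_sub_gaussErf_le hK0 hK1 h0 h1 hx)
  have hle := gaussErf_le_one (signScale K η * (x - a))
  have hge := neg_one_le_gaussErf (signScale K η * (x - a))
  have hbig := (one_sub_gaussErf_le (z := signScale K η * (K / 2)) (by positivity)).trans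
    (exp_neg_signScale_sq_le hK0 h0 h1)
  have hmul : ∀ {u v : ℝ}, u ≤ v → signScale K η * u ≤ signScale K η * v := fun h =>
    mul_le_mul_of_nonneg_left h (by linarith)
  refine ⟨abs_le.mpr ⟨by linarith, by linarith⟩, fun h => ?_, fun h => ?_, fun h => ?_, fun h => ?_⟩
  · have := gaussErf_monotone (hmul h)
    exact abs_le.mpr ⟨by linarith, by linarith⟩
  · have := gaussErf_monotone (hmul h)
    rw [mul_neg, gaussErf_neg] at this
    exact abs_le.mpr ⟨by linarith, by linarith⟩
  · have := gaussErf_monotone (hmul h)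
    rw [mul_zero, gaussErf_zero] at this
    linarith
  · have := gaussErf_monotone (hmul h)
    rw [mul_zero, gaussErf_zero] at this
    linarith

/-- The rectangle approximation at the scale used for matrix inversion. -/
theorem rectPoly_bounds {κ η x : ℝ} (hκ : 1 ≤ κ) (h0 : 0 < η) (h1 : η ≤ 1 / 2) (hx : |x| ≤ 1) :
    |1 - (rectPoly (1 / (2 * κ)) (1 / κ) η).eval x| ≤ 1 + η ∧
    (|x| ≤ 1 / (2 * κ) → |1 - (rectPoly (1 / (2 * κ)) (1 / κ) η).eval x| ≤ η) ∧
    (|x| ≤ 3 / (4 * κ) → |1 - (rectPoly (1 / (2 * κ)) (1 / κ) η).eval x| ≤ 1 / 2 + η) ∧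
    (1 / κ ≤ |x| → |(rectPoly (1 / (2 * κ)) (1 / κ) η).eval x| ≤ η) := by
  have hκ0 : 0 < κ := by linarith
  -- In units of q the jumps are centred at ±3q and settle within distance q, giving the thresholds
  -- 2q, 3q, 4q.
  obtain ⟨q, hq⟩ : ∃ q, q = 1 / (4 * κ) := ⟨_, rfl⟩
  have hq0 : 0 < q := by rw [hq]; positivity
  have hq1 : q ≤ 1 / 4 := by
    rw [hq]
    exact one_div_le_one_div_of_le (by norm_num) (by linarith)
  have e1 : 1 / κ = 4 * q := by rw [hq]; field_simp
  have e2 : 1 / (2 * κ) = 2 * q := by rw [hq]; field_simp; norm_num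
  have e3 : 3 / (4 * κ) = 3 * q := by rw [hq]; ring
  rw [e1, e2, e3]
  have hR : (rectPoly (2 * q) (4 * q) η).eval x =
      ((signPoly (-(3 * q)) (2 * q) η).eval x - (signPoly (3 * q) (2 * q) η).eval x) / 2 := by
    rw [rectPoly, show 2 * q + 4 * q / 4 = 3 * q by ring, show 4 * q / 2 = 2 * q by ring,
      eval_mul, eval_C, eval_sub]
    ring
  rw [abs_le] at hx
  obtain ⟨p0, p1, p2, p3, p4⟩ := signPoly_bounds (a := -(3 * q)) (K := 2 * q) (x := x)
    (by positivity) (by linarith) h0 h1 (abs_le.mpr ⟨by linarith, by linarith⟩)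
  obtain ⟨m0, m1, m2, m3, m4⟩ := signPoly_bounds (a := 3 * q) (K := 2 * q) (x := x)
    (by positivity) (by linarith) h0 h1 (abs_le.mpr ⟨by linarith, by linarith⟩)
  rw [hR]
  generalize (signPoly (-(3 * q)) (2 * q) η).eval x = u at *
  generalize (signPoly (3 * q) (2 * q) η).eval x = v at *
  simp only [abs_le] at p0 p1 p2 m0 m1 m2 ⊢
  -- For x ≥ 0 the jump at -3q is already settled, so only the one at 3q matters; x ≤ 0 is the
  -- mirror image.
  rcases le_total 0 x with hx0 | hx0
  · have hp := p1 (by linarith)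
    refine ⟨by constructor <;> linarith, fun h => ?_, fun h => ?_, fun h => ?_⟩
    · have := m2 (by linarith)
      constructor <;> linarith
    · have := m4 (by linarith)
      constructor <;> linarith
    · rw [le_abs] at h
      have := m1 (by rcases h with h | h <;> linarith)
      constructor <;> linarith
  · have hm := m2 (by linarith)
    refine ⟨by constructor <;> linarith, fun h => ?_, fun h => ?_, fun h => ?_⟩
    · have := p1 (by linarith)
      constructor <;> linarith
    · have := p3 (by linarith)
      constructor <;> linarith
    · rw [le_abs] at h
      have := p2 (by rcases h with h | h <;> linarith)
      constructor <;> linarith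

/-! ### Tails of the symmetric binomial distribution -/

theorem abs_eval_T_le_one (n : ℤ) {x : ℝ} (hx : x ∈ Set.Icc (-1 : ℝ) 1) :
    |(Chebyshev.T ℝ n).eval x| ≤ 1 := by
  rw [← Real.cos_arccos hx.1 hx.2, Chebyshev.T_real_cos]
  exact Real.abs_cos_le_one _

/-- The tail `2^{-2b} ∑_{i > j} (2b choose b + i)` of the symmetric binomial distribution. -/
noncomputable def binomTail (b j : ℕ) : ℝ :=
  (∑ i ∈ Finset.Icc (j + 1) b, (Nat.choose (2 * b) (b + i) : ℝ)) / 2 ^ (2 * b)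

theorem binomTail_nonneg (b j : ℕ) : 0 ≤ binomTail b j := by
  rw [binomTail]
  positivity

theorem binomTail_eq_zero {b j : ℕ} (h : b ≤ j) : binomTail b j = 0 := by
  rw [binomTail, Finset.Icc_eq_empty (by omega), Finset.sum_empty, zero_div]

theorem binomTail_sub_succ (b j : ℕ) :
    binomTail b j - binomTail b (j + 1) = (Nat.choose (2 * b) (b + (j + 1)) : ℝ) / 2 ^ (2 * b) := by
  rcases lt_or_ge j b with h | h
  · rw [binomTail, binomTail, ← Finset.insert_Icc_add_one_left_eq_Icc (show j + 1 ≤ b by omega),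
      Finset.sum_insert (by simp)]
    ring
  · rw [binomTail_eq_zero h, binomTail_eq_zero (by omega), Nat.choose_eq_zero_of_lt (by omega)]
    simp

theorem sum_range_two_mul_add_one {M : Type*} [AddCommMonoid M] (g : ℕ → M) (b : ℕ) :
    ∑ m ∈ Finset.range (2 * b + 1), g m =
      g b + ∑ i ∈ Finset.range b, (g (b + (i + 1)) + g (b - (i + 1))) := by
  rw [show 2 * b + 1 = b + (b + 1) by ring, Finset.sum_range_add, Finset.sum_range_succ',
    Finset.sum_add_distrib, ← Finset.sum_range_reflect g b]
  simp only [Nat.sub_sub, add_comm 1, add_zero]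
  abel

theorem two_mul_binomTail_zero (b : ℕ) :
    2 * binomTail b 0 = 1 - (Nat.choose (2 * b) b : ℝ) / 2 ^ (2 * b) := by
  have h := sum_range_two_mul_add_one (fun m => (Nat.choose (2 * b) m : ℝ)) b
  have h2 : ∑ m ∈ Finset.range (2 * b + 1), (Nat.choose (2 * b) m : ℝ) = 2 ^ (2 * b) := by
    exact_mod_cast Nat.sum_range_choose (2 * b)
  have h3 : ∑ i ∈ Finset.range b, (Nat.choose (2 * b) (b + (i + 1)) : ℝ) / 2 ^ (2 * b) =
      binomTail b 0 := by
    simp only [← binomTail_sub_succ]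
    rw [Finset.sum_range_sub', binomTail_eq_zero le_rfl, sub_zero]
  rw [h2, Finset.sum_congr rfl (g := fun i => 2 * (Nat.choose (2 * b) (b + (i + 1)) : ℝ)),
    ← Finset.mul_sum] at h
  · rw [← Finset.sum_div] at h3
    rw [← h3]
    field_simp
    linarith
  · intro i hi
    rw [Finset.mem_range] at hi
    rw [← Nat.choose_symm_of_eq_add (show 2 * b = (b - (i + 1)) + (b + (i + 1)) by omega)]
    ring

theorem binomTail_le_half (b j : ℕ) : binomTail b j ≤ 1 / 2 := by
  have hanti : Antitone (binomTail b) := antitone_nat_of_succ_le fun j => by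
    have h := binomTail_sub_succ b j
    have : 0 ≤ (Nat.choose (2 * b) (b + (j + 1)) : ℝ) / 2 ^ (2 * b) := by positivity
    linarith
  have h0 := two_mul_binomTail_zero b
  have : 0 ≤ (Nat.choose (2 * b) b : ℝ) / 2 ^ (2 * b) := by positivity
  linarith [hanti (Nat.zero_le j)]

/-- A Chernoff bound for the symmetric binomial distribution. -/
theorem binomTail_le_exp {b : ℕ} (hb : 0 < b) (j : ℕ) :
    binomTail b j ≤ Real.exp (-((j + 1 : ℝ) ^ 2 / b)) := by
  have hb' : (0 : ℝ) < b := by exact_mod_cast hb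
  -- This θ minimises -θ(j + 1) + bθ²/4, the exponent left after cosh(θ/2) ≤ e^{θ²/8}.
  set θ : ℝ := 2 * (j + 1) / b with hθ
  have hθ0 : 0 ≤ θ := by positivity
  have h1 : ∑ i ∈ Finset.Icc (j + 1) b, (Nat.choose (2 * b) (b + i) : ℝ) ≤
      ∑ m ∈ Finset.range (2 * b + 1),
        (Nat.choose (2 * b) m : ℝ) * Real.exp (θ * ((m : ℝ) - b - (j + 1))) := by
    calc ∑ i ∈ Finset.Icc (j + 1) b, (Nat.choose (2 * b) (b + i) : ℝ)
        ≤ ∑ i ∈ Finset.Icc (j + 1) b, (Nat.choose (2 * b) (b + i) : ℝ) *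
          Real.exp (θ * (((b + i : ℕ) : ℝ) - b - (j + 1))) := by
          refine Finset.sum_le_sum fun i hi => le_mul_of_one_le_right (by positivity) ?_
          have hi' : ((j + 1 : ℕ) : ℝ) ≤ i := by exact_mod_cast (Finset.mem_Icc.mp hi).1
          push_cast at hi' ⊢
          exact Real.one_le_exp (mul_nonneg hθ0 (by linarith))
      _ = ∑ m ∈ (Finset.Icc (j + 1) b).image (b + ·), (Nat.choose (2 * b) m : ℝ) *
          Real.exp (θ * ((m : ℝ) - b - (j + 1))) := by
          rw [Finset.sum_image fun _ _ _ _ h => by simpa using h]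
      _ ≤ _ := by
          refine Finset.sum_le_sum_of_subset_of_nonneg (fun m hm => ?_)
            fun _ _ _ => by positivity
          simp only [Finset.mem_image, Finset.mem_Icc, Finset.mem_range] at hm ⊢
          omega
  have h2 : ∑ m ∈ Finset.range (2 * b + 1),
      (Nat.choose (2 * b) m : ℝ) * Real.exp (θ * ((m : ℝ) - b - (j + 1))) =
      Real.exp (-(θ * (j + 1))) * (2 * Real.cosh (θ / 2)) ^ (2 * b) := by
    rw [Real.cosh_eq, mul_div_cancel₀ _ two_ne_zero, add_pow, Finset.mul_sum]
    refine Finset.sum_congr rfl fun m hm => ?_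
    have hm' : m ≤ 2 * b := by
      rw [Finset.mem_range] at hm
      omega
    rw [← Real.exp_nat_mul, ← Real.exp_nat_mul, Nat.cast_sub hm', ← mul_assoc, ← mul_assoc,
      ← Real.exp_add, ← Real.exp_add, mul_comm]
    congr 2
    push_cast
    ring
  have h3 : Real.cosh (θ / 2) ^ (2 * b) ≤ Real.exp ((j + 1 : ℝ) ^ 2 / b) := by
    calc Real.cosh (θ / 2) ^ (2 * b) ≤ Real.exp ((θ / 2) ^ 2 / 2) ^ (2 * b) :=
          pow_le_pow_left₀ (Real.cosh_pos _).le (Real.cosh_le_exp_half_sq _) _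
      _ = Real.exp ((j + 1 : ℝ) ^ 2 / b) := by
          rw [← Real.exp_nat_mul, hθ]
          congr 1
          push_cast
          field_simp
  rw [binomTail, div_le_iff₀ (by positivity)]
  refine h1.trans (h2.le.trans ?_)
  rw [mul_pow, mul_left_comm, mul_comm]
  refine mul_le_mul_of_nonneg_right ?_ (by positivity)
  calc Real.exp (-(θ * (j + 1))) * Real.cosh (θ / 2) ^ (2 * b)
      ≤ Real.exp (-(θ * (j + 1))) * Real.exp ((j + 1 : ℝ) ^ 2 / b) :=
        mul_le_mul_of_nonneg_left h3 (Real.exp_pos _).le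
    _ = Real.exp (-((j + 1 : ℝ) ^ 2 / b)) := by
        rw [← Real.exp_add, hθ]
        congr 1
        ring

/-! ### Chebyshev expansion of (1 - (1 - x²)^b)/x -/

/-- With W = e^{iφ}, 4 sin² φ = -(W - 1/W)². Expand its b-th power by the binomial theorem and pair
terms symmetric about the middle into cosines. -/
theorem one_sub_sq_pow_eq_sum_T (b : ℕ) {x : ℝ} (hx : x ∈ Set.Icc (-1 : ℝ) 1) :
    2 ^ (2 * b) * (1 - x ^ 2) ^ b = (Nat.choose (2 * b) b : ℝ) -
      2 * ∑ j ∈ Finset.range b, (-1) ^ j * (Nat.choose (2 * b) (b + (j + 1)) : ℝ) *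
        (Chebyshev.T ℝ (2 * (j : ℤ) + 2)).eval x := by
  obtain ⟨φ, rfl⟩ : ∃ φ, Real.cos φ = x := ⟨Real.arccos x, Real.cos_arccos hx.1 hx.2⟩
  simp only [Chebyshev.T_real_cos]
  set W : ℂ := Complex.exp (φ * Complex.I) with hW
  have hW0 : W ≠ 0 := Complex.exp_ne_zero _
  have hcos (n : ℕ) : W ^ n + W⁻¹ ^ n = 2 * Complex.cos (n * φ) := by
    rw [hW, ← Complex.exp_neg, ← Complex.exp_nat_mul, ← Complex.exp_nat_mul, Complex.cos]
    ring_nf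
  have hbase : (4 : ℂ) * (1 - Complex.cos φ ^ 2) = -(W - W⁻¹) ^ 2 := by
    have h := hcos 1
    simp only [pow_one, Nat.cast_one, one_mul] at h
    have : W * W⁻¹ = 1 := mul_inv_cancel₀ hW0
    linear_combination (W + W⁻¹ + 2 * Complex.cos φ) * h - 4 * this
  have hpow : (2 : ℂ) ^ (2 * b) * (1 - Complex.cos φ ^ 2) ^ b =
      (-1) ^ b * (W + -W⁻¹) ^ (2 * b) := by
    rw [pow_mul, ← mul_pow, show (2 : ℂ) ^ 2 = 4 by norm_num, hbase, neg_pow, ← pow_mul,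
      sub_eq_add_neg]
  rw [add_pow, sum_range_two_mul_add_one, mul_add, Finset.mul_sum] at hpow
  apply Complex.ofReal_injective
  push_cast
  rw [hpow, sub_eq_add_neg, Finset.mul_sum, ← Finset.sum_neg_distrib]
  congr 1
  · rw [show 2 * b - b = b by omega, neg_pow W⁻¹, inv_pow]
    have : ((-1 : ℂ) ^ b) * (-1) ^ b = 1 := by
      rw [← mul_pow]
      simp
    field_simp
    linear_combination (Nat.choose (2 * b) b : ℂ) * this
  · refine Finset.sum_congr rfl fun i hi => ?_
    rw [Finset.mem_range] at hi
    obtain ⟨d, rfl⟩ := Nat.exists_eq_add_of_le (show i + 1 ≤ b from hi)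
    rw [← Nat.choose_symm_of_eq_add (show 2 * (i + 1 + d) =
      ((i + 1 + d) - (i + 1)) + (i + 1 + d + (i + 1)) by omega)]
    have h := hcos (2 * (i + 1))
    rw [show i + 1 + d - (i + 1) = d by omega,
      show 2 * (i + 1 + d) - (i + 1 + d + (i + 1)) = d by omega,
      show 2 * (i + 1 + d) - d = 2 * (i + 1) + d by omega,
      show i + 1 + d + (i + 1) = 2 * (i + 1) + d by omega]
    have hc : Complex.cos ((2 * (i : ℂ) + 2) * φ) = Complex.cos (((2 * (i + 1) : ℕ) : ℂ) * φ) := by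
      push_cast
      ring_nf
    have hs : ((-1 : ℂ) ^ d) * (-1) ^ d = 1 := by
      rw [← mul_pow]
      simp
    have hWd : W ^ d * W⁻¹ ^ d = 1 := by
      rw [← mul_pow, mul_inv_cancel₀ hW0, one_pow]
    have hs2 : ((-1 : ℂ) ^ (2 * (i + 1))) = 1 := by
      rw [pow_mul]
      simp
    rw [hc, neg_pow W⁻¹ d, neg_pow W⁻¹ (2 * (i + 1) + d), pow_add W, pow_add W⁻¹,
      pow_add (-1 : ℂ) (2 * (i + 1)), hs2, pow_add (-1 : ℂ) (i + 1), pow_succ (-1 : ℂ) i]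
    generalize Complex.cos (((2 * (i + 1) : ℕ) : ℂ) * φ) = c at *
    generalize W ^ (2 * (i + 1)) = X at *
    generalize W⁻¹ ^ (2 * (i + 1)) = Y at *
    generalize ((-1 : ℂ) ^ d) = s at *
    generalize W ^ d = D at *
    generalize W⁻¹ ^ d = E at *
    generalize ((2 * (i + 1 + d)).choose d : ℂ) = A at *
    linear_combination (-(-1) ^ i * A * (X + Y) * (D * E)) * hs - (-1) ^ i * A * (X + Y) * hWd -
      (-1) ^ i * A * h

/-- The untruncated expansion represents `(1 - (1 - x²)^b) / x`. -/
theorem mul_sum_binomTail_T (b : ℕ) {x : ℝ} (hx : x ∈ Set.Icc (-1 : ℝ) 1) :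
    x * (4 * ∑ j ∈ Finset.range b, (-1) ^ j * binomTail b j *
      (Chebyshev.T ℝ (2 * (j : ℤ) + 1)).eval x) = 1 - (1 - x ^ 2) ^ b := by
  have hT (j : ℕ) : 2 * (x * (Chebyshev.T ℝ (2 * (j : ℤ) + 1)).eval x) =
      (Chebyshev.T ℝ (2 * (j : ℤ) + 2)).eval x + (Chebyshev.T ℝ (2 * (j : ℤ))).eval x := by
    rw [Chebyshev.T_add_two]
    simp
    ring
  -- Summation by parts based on 2xT_{2j+1} = T_{2j+2} + T_{2j}: differences of tails are single
  -- binomial coefficients, and the boundary term vanishes at M = b.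
  have habel (M : ℕ) : x * (4 * ∑ j ∈ Finset.range M, (-1) ^ j * binomTail b j *
      (Chebyshev.T ℝ (2 * (j : ℤ) + 1)).eval x) =
      2 * binomTail b 0 + 2 * (∑ j ∈ Finset.range M, (-1) ^ j *
        (binomTail b j - binomTail b (j + 1)) * (Chebyshev.T ℝ (2 * (j : ℤ) + 2)).eval x) -
      2 * (-1) ^ M * binomTail b M * (Chebyshev.T ℝ (2 * (M : ℤ))).eval x := by
    induction M with
    | zero => simp
    | succ M ih =>
      rw [Finset.sum_range_succ, mul_add, mul_add, ih, Finset.sum_range_succ, pow_succ]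
      push_cast
      rw [show 2 * ((M : ℤ) + 1) = 2 * M + 2 by ring]
      linear_combination 2 * (-1) ^ M * binomTail b M * hT M
  rw [habel, binomTail_eq_zero le_rfl, two_mul_binomTail_zero]
  have h := one_sub_sq_pow_eq_sum_T b hx
  simp only [binomTail_sub_succ]
  have hs : ∑ j ∈ Finset.range b, (-1) ^ j * ((Nat.choose (2 * b) (b + (j + 1)) : ℝ) / 2 ^ (2 * b)) *
      (Chebyshev.T ℝ (2 * (j : ℤ) + 2)).eval x =
      (∑ j ∈ Finset.range b, (-1) ^ j * (Nat.choose (2 * b) (b + (j + 1)) : ℝ) *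
        (Chebyshev.T ℝ (2 * (j : ℤ) + 2)).eval x) / 2 ^ (2 * b) := by
    rw [Finset.sum_div]
    exact Finset.sum_congr rfl fun j _ => by ring
  rw [hs]
  field_simp
  linarith

/-! ### The truncated approximation of 1/x -/

theorem invPoly_eval (η κ x : ℝ) : (invPoly η κ).eval x =
    4 * ∑ j ∈ Finset.range (invJ κ η + 1), (-1) ^ j * binomTail (invB κ η) j *
      (Chebyshev.T ℝ (2 * (j : ℤ) + 1)).eval x := by
  simp only [invPoly, eval_mul, eval_ofNat, eval_finsetSum, eval_C, binomTail]

/-- The parameters b and j₀ use base-2 logarithms while the exponential estimates need natural ones;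
this makes the former large enough. -/
theorem log_le_logb_two {y : ℝ} (hy : 1 ≤ y) : Real.log y ≤ Real.logb 2 y := by
  rw [Real.logb, le_div_iff₀ (Real.log_pos one_lt_two)]
  exact mul_le_of_le_one_right (Real.log_nonneg hy) (by linarith [Real.log_two_lt_d9])

theorem mul_log_le_invB {κ η : ℝ} (hκ : 1 ≤ κ) (h0 : 0 < η) (h1 : η ≤ 1) :
    κ ^ 2 * Real.log (κ / η) ≤ invB κ η := by
  refine le_trans ?_ (Nat.le_ceil _)
  refine mul_le_mul_of_nonneg_left (log_le_logb_two ?_) (sq_nonneg κ)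
  rw [one_le_div h0]
  linarith

theorem invB_pos {κ η : ℝ} (hκ : 1 ≤ κ) (h0 : 0 < η) (h1 : η < 1) : 0 < invB κ η := by
  have h := mul_log_le_invB hκ h0 h1.le
  have hl : 0 < Real.log (κ / η) := Real.log_pos (by rw [one_lt_div h0]; linarith)
  have : (0 : ℝ) < invB κ η := lt_of_lt_of_le (by positivity) h
  exact_mod_cast this

theorem mul_log_le_invJ_sq {κ η : ℝ} (hκ : 1 ≤ κ) (h0 : 0 < η) (h1 : η < 1) :
    (invB κ η : ℝ) * Real.log (4 * (invB κ η : ℝ) / η) ≤ (invJ κ η : ℝ) ^ 2 := by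
  have hb : (1 : ℝ) ≤ invB κ η := by exact_mod_cast invB_pos hκ h0 h1
  have h4 : 1 ≤ 4 * (invB κ η : ℝ) / η := by
    rw [one_le_div h0]
    linarith
  have hlog := log_le_logb_two h4
  have h := Real.sqrt_le_iff.mp (Nat.le_ceil (Real.sqrt ((invB κ η : ℝ) *
    Real.logb 2 (4 * (invB κ η : ℝ) / η))))
  exact (mul_le_mul_of_nonneg_left hlog (by linarith)).trans h.2

theorem invJ_pos {κ η : ℝ} (hκ : 1 ≤ κ) (h0 : 0 < η) (h1 : η < 1) : 0 < invJ κ η := by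
  have hb : (1 : ℝ) ≤ invB κ η := by exact_mod_cast invB_pos hκ h0 h1
  have hl : 0 < Real.log (4 * (invB κ η : ℝ) / η) :=
    Real.log_pos (by rw [one_lt_div h0]; linarith)
  refine Nat.pos_of_ne_zero fun hJ => ?_
  have h := mul_log_le_invJ_sq hκ h0 h1
  rw [hJ, Nat.cast_zero, zero_pow two_ne_zero] at h
  have : 0 < (invB κ η : ℝ) * Real.log (4 * (invB κ η : ℝ) / η) := by positivity
  linarith

theorem abs_term_le (b j : ℕ) {x : ℝ} (hx : x ∈ Set.Icc (-1 : ℝ) 1) :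
    |(-1) ^ j * binomTail b j * (Chebyshev.T ℝ (2 * (j : ℤ) + 1)).eval x| ≤ binomTail b j := by
  rw [abs_mul, abs_mul, abs_neg_one_pow, one_mul, abs_of_nonneg (binomTail_nonneg b j)]
  exact mul_le_of_le_one_right (binomTail_nonneg b j) (abs_eval_T_le_one _ hx)

theorem abs_invPoly_eval_le (η κ : ℝ) {x : ℝ} (hx : x ∈ Set.Icc (-1 : ℝ) 1) :
    |(invPoly η κ).eval x| ≤ 2 * ((invJ κ η : ℝ) + 1) := by
  rw [invPoly_eval, abs_mul, abs_of_pos (by norm_num : (0 : ℝ) < 4)]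
  have h := (Finset.abs_sum_le_sum_abs _ _).trans (Finset.sum_le_card_nsmul
    (Finset.range (invJ κ η + 1)) _ (1 / 2) fun j _ =>
      (abs_term_le (invB κ η) j hx).trans (binomTail_le_half _ j))
  rw [Finset.card_range, nsmul_eq_mul] at h
  push_cast at h
  linarith

theorem abs_full_sub_invPoly_le {κ η x : ℝ} (hκ : 1 ≤ κ) (h0 : 0 < η) (h1 : η < 1)
    (hx : x ∈ Set.Icc (-1 : ℝ) 1) :
    |4 * ∑ j ∈ Finset.range (invB κ η), (-1) ^ j * binomTail (invB κ η) j *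
      (Chebyshev.T ℝ (2 * (j : ℤ) + 1)).eval x - (invPoly η κ).eval x| ≤ η := by
  have hb := invB_pos hκ h0 h1
  have hJ := mul_log_le_invJ_sq hκ h0 h1
  rw [invPoly_eval, ← mul_sub, abs_mul, abs_of_pos (by norm_num : (0 : ℝ) < 4)]
  set b := invB κ η
  set J := invJ κ η
  have hb' : (0 : ℝ) < b := by exact_mod_cast hb
  -- If b ≤ J + 1 nothing is truncated, since the tails vanish from index b on. Otherwise fewer than
  -- b terms are dropped, each at most η/(4b).
  rcases le_total b (J + 1) with h | h
  · rw [Finset.sum_subset (Finset.range_mono h), sub_self, abs_zero, mul_zero]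
    · exact h0.le
    · intro j _ hj
      rw [binomTail_eq_zero (by simpa using hj)]
      ring
  · have htail (j : ℕ) (hj : j ∈ Finset.Ico (J + 1) b) : binomTail b j ≤ η / (4 * b) := by
      have hj' : ((J + 1 : ℕ) : ℝ) ≤ j := by exact_mod_cast (Finset.mem_Ico.mp hj).1
      push_cast at hj'
      have hJ0 : (0 : ℝ) ≤ J := Nat.cast_nonneg _
      calc binomTail b j ≤ Real.exp (-((j + 1 : ℝ) ^ 2 / b)) := binomTail_le_exp hb j
        _ ≤ Real.exp (-Real.log (4 * b / η)) := by
          refine Real.exp_le_exp.mpr (neg_le_neg ?_)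
          rw [le_div_iff₀ hb', mul_comm]
          exact hJ.trans (pow_le_pow_left₀ hJ0 (by linarith) 2)
        _ = η / (4 * b) := by
          rw [Real.exp_neg, Real.exp_log (by positivity), inv_div]
    rw [← Finset.sum_Ico_eq_sub _ h]
    have hs := (Finset.abs_sum_le_sum_abs _ _).trans (Finset.sum_le_card_nsmul
      (Finset.Ico (J + 1) b) _ (η / (4 * b)) fun j hj => (abs_term_le b j hx).trans (htail j hj))
    rw [Nat.card_Ico, nsmul_eq_mul] at hs
    have hcard : ((b - (J + 1) : ℕ) : ℝ) ≤ b := by exact_mod_cast Nat.sub_le _ _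
    calc _ ≤ 4 * (((b - (J + 1) : ℕ) : ℝ) * (η / (4 * b))) :=
          mul_le_mul_of_nonneg_left hs (by norm_num)
      _ ≤ 4 * ((b : ℝ) * (η / (4 * b))) := by gcongr
      _ = η := by field_simp

/-- Because (1 - x²)^b lies in [0, 1], the full sum is at most 1/|x| in absolute value, even inside
the gap |x| < 1/κ; truncation adds η. -/
theorem abs_invPoly_eval_le_inv {κ η x : ℝ} (hκ : 1 ≤ κ) (h0 : 0 < η) (h1 : η < 1)
    (hx : x ∈ Set.Icc (-1 : ℝ) 1) (hx0 : x ≠ 0) :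
    |(invPoly η κ).eval x| ≤ 1 / |x| + η := by
  have hm := mul_sum_binomTail_T (invB κ η) hx
  have ht := abs_full_sub_invPoly_le hκ h0 h1 hx
  set S := 4 * ∑ j ∈ Finset.range (invB κ η), (-1) ^ j * binomTail (invB κ η) j *
      (Chebyshev.T ℝ (2 * (j : ℤ) + 1)).eval x
  have hx2 : x ^ 2 ≤ 1 := by nlinarith [hx.1, hx.2]
  have hp0 : 0 ≤ (1 - x ^ 2) ^ invB κ η := pow_nonneg (by linarith) _
  have hp1 : (1 - x ^ 2) ^ invB κ η ≤ 1 := pow_le_one₀ (by linarith) (by nlinarith)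
  have hS : |S| ≤ 1 / |x| := by
    rw [le_div_iff₀ (abs_pos.mpr hx0), ← abs_mul, mul_comm, hm, abs_le]
    constructor <;> linarith
  have h := abs_sub_abs_le_abs_sub ((invPoly η κ).eval x) S
  rw [abs_sub_comm] at ht
  linarith

theorem abs_invPoly_eval_sub_inv_le {κ η x : ℝ} (hκ : 1 ≤ κ) (h0 : 0 < η) (h1 : η < 1)
    (hx : x ∈ Set.Icc (-1 : ℝ) 1) (hxκ : 1 / κ ≤ |x|) :
    |(invPoly η κ).eval x - 1 / x| ≤ 2 * η := by
  have hκ0 : 0 < κ := by linarith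
  have hxpos : 0 < |x| := lt_of_lt_of_le (by positivity) hxκ
  have hx0 : x ≠ 0 := abs_pos.mp hxpos
  have hm := mul_sum_binomTail_T (invB κ η) hx
  have ht := abs_full_sub_invPoly_le hκ h0 h1 hx
  set S := 4 * ∑ j ∈ Finset.range (invB κ η), (-1) ^ j * binomTail (invB κ η) j *
      (Chebyshev.T ℝ (2 * (j : ℤ) + 1)).eval x
  have hx2 : x ^ 2 ≤ 1 := by nlinarith [hx.1, hx.2]
  have hlow : 1 / κ ^ 2 ≤ x ^ 2 := by
    rw [← sq_abs x, ← one_div_pow]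
    exact pow_le_pow_left₀ (by positivity) hxκ 2
  -- Here 1 - x² ≤ e^{-1/κ²} and b ≥ κ² log(κ/η). The extra 1/κ absorbs the later division by |x| ≥
  -- 1/κ.
  have hp : (1 - x ^ 2) ^ invB κ η ≤ η / κ := by
    calc (1 - x ^ 2) ^ invB κ η ≤ Real.exp (-(1 / κ ^ 2)) ^ invB κ η := by
          refine pow_le_pow_left₀ (by linarith) ?_ _
          linarith [Real.add_one_le_exp (-(1 / κ ^ 2))]
      _ = Real.exp (-((invB κ η : ℝ) / κ ^ 2)) := by
          rw [← Real.exp_nat_mul]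
          congr 1
          ring
      _ ≤ Real.exp (-Real.log (κ / η)) := by
          refine Real.exp_le_exp.mpr (neg_le_neg ?_)
          rw [le_div_iff₀ (by positivity), mul_comm]
          exact mul_log_le_invB hκ h0 h1.le
      _ = η / κ := by rw [Real.exp_neg, Real.exp_log (by positivity), inv_div]
  have hp0 : 0 ≤ (1 - x ^ 2) ^ invB κ η := pow_nonneg (by linarith) _
  have hS : |S - 1 / x| ≤ η := by
    rw [show S - 1 / x = -((1 - x ^ 2) ^ invB κ η / x) by field_simp; linarith, abs_neg, abs_div,
      abs_of_nonneg hp0, div_le_iff₀ hxpos]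
    refine hp.trans ?_
    rw [div_eq_mul_one_div]
    exact mul_le_mul_of_nonneg_left hxκ h0.le
  have h := abs_sub_le ((invPoly η κ).eval x) S (1 / x)
  rw [abs_sub_comm] at ht
  linarith

/-! ### The composite polynomial -/

theorem miPoly_eval (ε κ x : ℝ) : (miPoly ε κ).eval x =
    (1 - (rectPoly (1 / (2 * κ)) (1 / κ) (epsRect ε κ)).eval x) *
      (invPoly (ε / 2) κ).eval x / ((1 + ε / 2) * (2 * κ)) := by
  simp only [miPoly, epsInv, eval_mul, eval_C, eval_sub, eval_one]
  field_simp

theorem epsRect_pos {κ ε : ℝ} (hκ : 1 ≤ κ) (hε0 : 0 < ε) (hε1 : ε < 1) : 0 < epsRect ε κ := by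
  have hJ : (0 : ℝ) < invJ κ (ε / 2) := by
    exact_mod_cast invJ_pos hκ (half_pos hε0) (by linarith)
  exact lt_min (by positivity) (div_pos (by linarith) (by rw [epsInv]; positivity))

theorem abs_miPoly_eval_le_one {κ ε x : ℝ} (hκ : 1 ≤ κ) (hε0 : 0 < ε) (hε1 : ε < 1)
    (hx : x ∈ Set.Icc (-1 : ℝ) 1) : |(miPoly ε κ).eval x| ≤ 1 := by
  have hκ0 : 0 < κ := by linarith
  obtain ⟨η, rfl⟩ : ∃ η, ε = 2 * η := ⟨ε / 2, by ring⟩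
  have hr0 := epsRect_pos hκ hε0 hε1
  have hrη : epsRect (2 * η) κ ≤ η := (min_le_left _ _).trans (by linarith)
  have hrJ : epsRect (2 * η) κ ≤ κ / (2 * (invJ κ η : ℝ)) := by
    have : epsRect (2 * η) κ ≤ κ / (2 * (invJ κ (epsInv (2 * η)) : ℝ)) := min_le_right _ _
    rwa [show epsInv (2 * η) = η by rw [epsInv]; ring] at this
  have hη0 : 0 < η := by linarith
  have hη1 : η < 1 / 2 := by linarith
  obtain ⟨r1, r2, r3, -⟩ := rectPoly_bounds hκ hr0 (by linarith) (abs_le.mpr hx)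
  rw [miPoly_eval, show 2 * η / 2 = η by ring, abs_div, abs_mul,
    abs_of_pos (show 0 < (1 + η) * (2 * κ) by positivity), div_le_one (by positivity)]
  set R := |1 - (rectPoly (1 / (2 * κ)) (1 / κ) (epsRect (2 * η) κ)).eval x|
  have hR0 : 0 ≤ R := abs_nonneg _
  have hQ0 : 0 ≤ |(invPoly η κ).eval x| := abs_nonneg _
  -- Three zones, each to be bounded by (1 + η)·2κ: up to 1/(2κ) the small factor κ/(2j₀) beats 2(j₀
  -- + 1); up to 3/(4κ) a factor 1/2 + η offsets 2κ + η; beyond, 1/|x| ≤ 4κ/3 leaves room for η.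
  rcases le_or_gt |x| (1 / (2 * κ)) with hsmall | hlarge
  · have hJ : (1 : ℝ) ≤ invJ κ η := by exact_mod_cast invJ_pos hκ hη0 (by linarith)
    have hQ := abs_invPoly_eval_le η κ hx
    calc R * |(invPoly η κ).eval x| ≤ κ / (2 * (invJ κ η : ℝ)) * (2 * ((invJ κ η : ℝ) + 1)) :=
          mul_le_mul ((r2 hsmall).trans hrJ) hQ hQ0 (by positivity)
      _ = κ * (((invJ κ η : ℝ) + 1) / (invJ κ η : ℝ)) := by field_simp
      _ ≤ κ * 2 := by
          refine mul_le_mul_of_nonneg_left ?_ hκ0.le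
          rw [div_le_iff₀ (by linarith)]
          linarith
      _ ≤ (1 + η) * (2 * κ) := by nlinarith
  have hx0 : 0 < |x| := lt_trans (by positivity) hlarge
  have hQ := abs_invPoly_eval_le_inv hκ hη0 (by linarith) hx (abs_pos.mp hx0)
  rcases le_or_gt |x| (3 / (4 * κ)) with hmid | hfar
  · have hinv : 1 / |x| ≤ 2 * κ := by
      rw [div_le_iff₀ hx0]
      rw [div_lt_iff₀ (by positivity)] at hlarge
      linarith
    calc R * |(invPoly η κ).eval x| ≤ (1 / 2 + η) * (2 * κ + η) :=
          mul_le_mul ((r3 hmid).trans (by linarith)) (by linarith) hQ0 (by positivity)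
      _ ≤ (1 + η) * (2 * κ) := by nlinarith
  · have hinv : 1 / |x| ≤ 4 / 3 * κ := by
      rw [div_le_iff₀ hx0]
      rw [div_lt_iff₀ (by positivity)] at hfar
      linarith
    calc R * |(invPoly η κ).eval x| ≤ (1 + η) * (4 / 3 * κ + η) :=
          mul_le_mul (r1.trans (by linarith)) (by linarith) hQ0 (by positivity)
      _ ≤ (1 + η) * (2 * κ) := by
          refine mul_le_mul_of_nonneg_left ?_ (by linarith)
          linarith

theorem abs_miPoly_eval_sub_le {κ ε x : ℝ} (hκ : 1 ≤ κ) (hε0 : 0 < ε) (hε1 : ε < 1)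
    (hx : x ∈ Set.Icc (-1 : ℝ) 1) (hxκ : 1 / κ ≤ |x|) :
    |(miPoly ε κ).eval x - 1 / (2 * κ * x)| ≤ ε := by
  have hκ0 : 0 < κ := by linarith
  have hxpos : 0 < |x| := lt_of_lt_of_le (by positivity) hxκ
  have hx0 : x ≠ 0 := abs_pos.mp hxpos
  obtain ⟨η, rfl⟩ : ∃ η, ε = 2 * η := ⟨ε / 2, by ring⟩
  have hη0 : 0 < η := by linarith
  have hη1 : η < 1 / 2 := by linarith
  have hr0 := epsRect_pos hκ hε0 hε1
  have hrη : epsRect (2 * η) κ ≤ η := (min_le_left _ _).trans (by linarith)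
  obtain ⟨r1, -, -, r4⟩ := rectPoly_bounds hκ hr0 (by linarith) (abs_le.mpr hx)
  have hQ := abs_invPoly_eval_sub_inv_le hκ hη0 (by linarith) hx hxκ
  have hR := r4 hxκ
  rw [miPoly_eval, show 2 * η / 2 = η by ring]
  set R := (rectPoly (1 / (2 * κ)) (1 / κ) (epsRect (2 * η) κ)).eval x
  set Q := (invPoly η κ).eval x
  have hinv : |1 / x| ≤ κ := by
    rw [abs_div, abs_one, div_le_iff₀ hxpos]
    rw [div_le_iff₀ hκ0] at hxκ
    linarith
  -- The numerator separates the errors of the inverse, of the rectangle, and of the normalisation 1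
  -- + η.
  rw [show (1 - R) * Q / ((1 + η) * (2 * κ)) - 1 / (2 * κ * x) =
    ((1 - R) * (Q - 1 / x) - R * (1 / x) - η * (1 / x)) / ((1 + η) * (2 * κ)) by
      field_simp
      ring, abs_div, abs_of_pos (show 0 < (1 + η) * (2 * κ) by positivity),
    div_le_iff₀ (by positivity)]
  have h1 : |(1 - R) * (Q - 1 / x)| ≤ (1 + η) * (2 * η) := by
    rw [abs_mul]
    exact mul_le_mul (r1.trans (by linarith)) hQ (abs_nonneg _) (by positivity)
  have h2 : |R * (1 / x)| ≤ η * κ := by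
    rw [abs_mul]
    exact mul_le_mul (hR.trans hrη) hinv (abs_nonneg _) hη0.le
  have h3 : |η * (1 / x)| ≤ η * κ := by
    rw [abs_mul, abs_of_pos hη0]
    exact mul_le_mul_of_nonneg_left hinv hη0.le
  have h4 := abs_sub ((1 - R) * (Q - 1 / x) - R * (1 / x)) (η * (1 / x))
  have h5 := abs_sub ((1 - R) * (Q - 1 / x)) (R * (1 / x))
  -- The total 2η(1 + η) + 2ηκ is at most 2η·(1 + η)·2κ because κ ≥ 1.
  nlinarith [mul_pos hη0 hκ0, mul_nonneg hη0.le (sub_nonneg.mpr hκ),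
    mul_nonneg (sq_nonneg η) (sub_nonneg.mpr hκ)]

end MatrixInversion

theorem mainTheorem9 (κ ε : ℝ) (hκ : 1 ≤ κ) (hε0 : 0 < ε) (hε1 : ε < 1) :
    (∀ x ∈ Set.Icc (-1 : ℝ) 1, |(MatrixInversion.miPoly ε κ).eval x| ≤ 1) ∧
    (∀ x ∈ MatrixInversion.invDomain κ,
      |(MatrixInversion.miPoly ε κ).eval x
        - (1 - MatrixInversion.rect (κ * x)) / (2 * κ * x)| ≤ ε) := by
  refine ⟨fun x hx => MatrixInversion.abs_miPoly_eval_le_one hκ hε0 hε1 hx, fun x hx => ?_⟩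
  have hκ0 : 0 < κ := by linarith
  have hκ1 : 1 / κ ≤ 1 := by
    rw [div_le_one hκ0]
    exact hκ
  have hκpos : 0 < 1 / κ := by positivity
  have hdom : x ∈ Set.Icc (-1 : ℝ) 1 ∧ 1 / κ ≤ |x| := by
    rcases hx with hx | hx
    · exact ⟨⟨hx.1, by linarith [hx.2]⟩, le_abs.mpr (Or.inr (by linarith [hx.2]))⟩
    · exact ⟨⟨by linarith [hx.1], hx.2⟩, le_abs.mpr (Or.inl hx.1)⟩
  have hκx : 1 ≤ |κ * x| := by
    rw [abs_mul, abs_of_pos hκ0, mul_comm, ← div_le_iff₀ hκ0]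
    exact hdom.2
  have hrect : MatrixInversion.rect (κ * x) = 0 := by
    rw [MatrixInversion.rect, if_neg (by linarith), if_neg (by linarith)]
  rw [hrect, sub_zero]
  exact MatrixInversion.abs_miPoly_eval_sub_le hκ hε0 hε1 hdom.1 hdom.2
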